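/- Let $\Gamma$ be a finite simplicial graph which is connected and anti-connected (i.e. the complement graph of $\Gamma$ is also connected), and let $A(\Gamma)$ be the right-angled Artin group of $\Gamma$: it is generated by the vertices of $\Gamma$, subject to the relations $[v,w]=1$ for all edges $\{v,w\}$ of $\Gamma$. A word in the vertex generators and their inverses is *reduced* if it has minimal length among all words representing the same element of $A(\Gamma)$, and $\ell(g)$ denotes the length of a reduced word representing $g\in A(\Gamma)$. A *join* of $\Gamma$ is an induced subgraph $J$ whose vertex set is a disjoint union $J_1\sqcup J_2$ of two nonempty sets such that every vertex of $J_1$ is adjacent to every vertex of $J_2$; $A(J)\le A(\Gamma)$ is the subgroup generated by the vertices of $J$. A *join word* is a word all of whose letters are vertices, or inverses of vertices, of a single join $J$ of $\Gamma$; a *join subword* of a word is a subword (of consecutive letters) that is a join word. An element of $A(\Gamma)$ is *loxodromic* if it is not conjugate into $A(J)$ for any join $J$ of $\Gamma$, and a subgroup $H\le A(\Gamma)$ is *purely loxodromic* if every nontrivial element of $H$ is loxodromic. Theorem. Let $H\le A(\Gamma)$ be a finitely generated purely loxodromic subgroup. Then there is a natural number $N=N(H)$ such that $H$ is *$N$-join-busting*: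 for every reduced word $w$ representing an element of $H$ and every join subword $\beta$ of $w$, one has $\ell(\beta)\le N$. -/

import Mathlib

namespace RAAG

/-- The defining relators of the right-angled Artin group of `Γ`: the commutators `[v, w]` of
adjacent vertices. -/
def relators {V : Type*} (Γ : SimpleGraph V) : Set (FreeGroup V) :=
  {r | ∃ v w : V, Γ.Adj v w ∧
    r = FreeGroup.of v * FreeGroup.of w * (FreeGroup.of v)⁻¹ * (FreeGroup.of w)⁻¹}

/-- The right-angled Artin group `A(Γ)`: generated by the vertices of `Γ`, subject to the relations
that adjacent vertices commute. -/
abbrev Artin {V : Type*} (Γ : SimpleGraph V) : Type _ :=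
  PresentedGroup (relators Γ)

/-- The vertex generator of `A(Γ)` attached to the vertex `v`. -/
def gen {V : Type*} (Γ : SimpleGraph V) (v : V) : Artin Γ :=
  PresentedGroup.of v

/-- The element of `A(Γ)` denoted by a letter: `(v, true)` stands for `v` and `(v, false)` for
`v⁻¹`. -/
def letter {V : Type*} (Γ : SimpleGraph V) (a : V × Bool) : Artin Γ :=
  if a.2 then gen Γ a.1 else (gen Γ a.1)⁻¹

/-- The element of `A(Γ)` represented by a word in the vertex generators and their inverses. -/
def eval {V : Type*} (Γ : SimpleGraph V) (w : List (V × Bool)) : Artin Γ :=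
  (w.map (letter Γ)).prod

/-- Every element of `A(Γ)` is represented by a word. -/
theorem exists_eval_eq {V : Type*} (Γ : SimpleGraph V) (g : Artin Γ) :
    ∃ w : List (V × Bool), eval Γ w = g := by
  obtain ⟨x, rfl⟩ := PresentedGroup.mk_surjective (relators Γ) g
  have key : ∀ w : List (V × Bool),
      eval Γ w = PresentedGroup.mk (relators Γ) (FreeGroup.mk w) := by
    intro w
    induction w with
    | nil => exact (map_one (PresentedGroup.mk (relators Γ))).symm
    | cons a w ih =>
      have h1 : eval Γ (a :: w) = letter Γ a * eval Γ w := by simp [eval]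
      have h2 : FreeGroup.mk (a :: w) = FreeGroup.mk [a] * FreeGroup.mk w := by
        simp [FreeGroup.mul_mk]
      have h3 : letter Γ a = PresentedGroup.mk (relators Γ) (FreeGroup.mk [a]) := by
        rcases a with ⟨v, _ | _⟩
        · have : (FreeGroup.mk [(v, false)]) = (FreeGroup.of v)⁻¹ := rfl
          rw [this, map_inv]
          rfl
        · rfl
      rw [h1, h2, map_mul, ih, h3]
  obtain ⟨w, rfl⟩ := Quot.exists_rep x
  exact ⟨w, key w⟩

/-- The word length `ℓ(g)` of an element of `A(Γ)` with respect to the vertex generators: the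
minimal length of a word representing `g` (there is one, by `exists_eval_eq`). -/
noncomputable def wordLength {V : Type*} (Γ : SimpleGraph V) (g : Artin Γ) : ℕ :=
  sInf {n | ∃ w : List (V × Bool), eval Γ w = g ∧ w.length = n}

/-- A word is reduced if it has minimal length among all words representing the same element. -/
def IsReduced {V : Type*} (Γ : SimpleGraph V) (w : List (V × Bool)) : Prop :=
  ∀ w' : List (V × Bool), eval Γ w' = eval Γ w → w.length ≤ w'.length

/-- The support of a word: the vertices `v` such that `v` or `v⁻¹` occurs in it as a letter. -/
def support {V : Type*} (w : List (V × Bool)) : Set V :=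
  {v | (v, true) ∈ w ∨ (v, false) ∈ w}

/-- The subgraph of `Γ` induced on the vertex set `J` is a join: `J` is the disjoint union of two
nonempty sets such that each vertex of the first is adjacent to each vertex of the second. -/
def IsJoin {V : Type*} (Γ : SimpleGraph V) (J : Set V) : Prop :=
  ∃ J₁ J₂ : Set V, J₁.Nonempty ∧ J₂.Nonempty ∧ Disjoint J₁ J₂ ∧ J₁ ∪ J₂ = J ∧
    ∀ v ∈ J₁, ∀ w ∈ J₂, Γ.Adj v w

/-- The subgroup `A(J)` of `A(Γ)` generated by the vertices in `J`. -/
def vertexSubgroup {V : Type*} (Γ : SimpleGraph V) (J : Set V) : Subgroup (Artin Γ) :=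
  Subgroup.closure (gen Γ '' J)

/-- A word is a join word if its support lies in some join of `Γ`. -/
def IsJoinWord {V : Type*} (Γ : SimpleGraph V) (w : List (V × Bool)) : Prop :=
  ∃ J : Set V, IsJoin Γ J ∧ support w ⊆ J

/-- An element is elliptic if it is conjugate into a join subgroup `A(J)`. -/
def IsElliptic {V : Type*} (Γ : SimpleGraph V) (g : Artin Γ) : Prop :=
  ∃ J : Set V, IsJoin Γ J ∧ ∃ x : Artin Γ, x * g * x⁻¹ ∈ vertexSubgroup Γ J

/-- An element is loxodromic if it is not elliptic. -/
def IsLoxodromic {V : Type*} (Γ : SimpleGraph V) (g : Artin Γ) : Prop :=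
  ¬ IsElliptic Γ g

/-- A subgroup is purely loxodromic if all its nontrivial elements are loxodromic. -/
def IsPurelyLoxodromic {V : Type*} (Γ : SimpleGraph V) (H : Subgroup (Artin Γ)) : Prop :=
  ∀ h ∈ H, h ≠ 1 → IsLoxodromic Γ h

/-- A subgroup `H` is `N`-join-busting if, for each reduced word `w` representing an element of `H`
and each subword `β` of `w` (consisting of consecutive letters) that is a join word,
`ℓ(β) ≤ N`. -/
def IsJoinBusting {V : Type*} (Γ : SimpleGraph V) (H : Subgroup (Artin Γ)) (N : ℕ) : Prop :=
  ∀ w : List (V × Bool), IsReduced Γ w → eval Γ w ∈ H →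
    ∀ β : List (V × Bool), β <:+: w → IsJoinWord Γ β → wordLength Γ (eval Γ β) ≤ N

end RAAG

namespace RAAG

/-! The wall dual to the edge from `g` to `gv` is the coset of A(lk v) through `g`, and `side g W`
records whether `W` separates 1 from `g`. A reduced word crosses no wall twice, and two walls with
all four quadrants inhabited have adjacent labels. The stabiliser of a wall is a conjugate of some
A(lk v), which is trivial or lies in a join subgroup up to conjugacy, so a purely loxodromic H acts
freely on walls.

Let a subword β of a reduced word for h ∈ H use letters of an anti-connected set L with nonempty
common link lk L, and follow a geodesic of H from 1 to h. While it passes the middle of β, every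
wall between its point p and the coset of A(L ∪ lk L) containing β separates p from both 1 and h
(`exists_gate_of_between`). The geodesic crosses such a wall twice, and freeness leaves finitely
many of these walls up to translation (`exists_finite_walls`), so p is boundedly close to the coset.
Two points with the same offset from the coset differ by an element conjugate into a join subgroup,
hence coincide. So boundedly many steps pass the middle of β, and each crosses boundedly many walls
(`exists_bound_of_nested`).

In general, induct on L. If L is itself a join, sort the letters by factor and add the two bounds.
Otherwise subwords omitting a letter of L are bounded, so long ones use all of L; non-adjacent
letters have nested walls, and chaining these through the anti-connected L (`nested_of_long`) puts
walls of every label before and behind the middle of β. -/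

variable {V : Type*} {Γ : SimpleGraph V}

/-! ### Walls and the sides of walls -/

/-- The walls of the Cayley graph of `A(Γ)`: a wall with label `v` is a coset of the subgroup
generated by the link of `v`. -/
abbrev Wall (Γ : SimpleGraph V) : Type _ :=
  Σ v : V, Artin Γ ⧸ vertexSubgroup Γ (Γ.neighborSet v)

/-- The wall dual to the edge of the Cayley graph from `1` to a letter. -/
def wallOf (Γ : SimpleGraph V) (a : V × Bool) : Wall Γ :=
  if a.2 then ⟨a.1, QuotientGroup.mk 1⟩ else ⟨a.1, QuotientGroup.mk (gen Γ a.1)⁻¹⟩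

theorem gen_mul_comm {v w : V} (h : Γ.Adj v w) :
    gen Γ v * gen Γ w = gen Γ w * gen Γ v := by
  have h1 : (PresentedGroup.mk (relators Γ)
      (FreeGroup.of v * FreeGroup.of w * (FreeGroup.of v)⁻¹ * (FreeGroup.of w)⁻¹)) = 1 :=
    PresentedGroup.one_of_mem ⟨v, w, h, rfl⟩
  simp only [map_mul, map_inv] at h1
  exact mul_inv_eq_iff_eq_mul.mp (mul_inv_eq_one.mp h1)

theorem gen_commute {v w : V} (h : Γ.Adj v w) : Commute (gen Γ v) (gen Γ w) :=
  gen_mul_comm h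

theorem letter_commute {a b : V × Bool} (h : Γ.Adj a.1 b.1) :
    Commute (letter Γ a) (letter Γ b) := by
  have := gen_commute h
  unfold letter
  split_ifs <;> simp [this]

@[simp] theorem smul_label (g : Artin Γ) (W : Wall Γ) : (g • W).1 = W.1 := rfl

@[simp] theorem wallOf_label (a : V × Bool) : (wallOf Γ a).1 = a.1 := by
  unfold wallOf; split_ifs <;> rfl

open Classical in
/-- The action of a generator on two-colourings of the walls: translate the colouring, then change
the colour of the wall dual to the edge from `1` to the generator. -/
noncomputable def wallPerm (Γ : SimpleGraph V) (v : V) : Equiv.Perm (Wall Γ → Bool) where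
  toFun φ := fun W => xor (decide (W = wallOf Γ (v, true))) (φ ((gen Γ v)⁻¹ • W))
  invFun φ := fun W => xor (decide (gen Γ v • W = wallOf Γ (v, true))) (φ (gen Γ v • W))
  left_inv φ := by funext W; simp
  right_inv φ := by funext W; simp

theorem gen_smul_wallOf {v w : V} (h : Γ.Adj v w) :
    gen Γ v • wallOf Γ (w, true) = wallOf Γ (w, true) := by
  have : gen Γ v ∈ vertexSubgroup Γ (Γ.neighborSet w) :=
    Subgroup.subset_closure ⟨v, h.symm, rfl⟩
  simp only [wallOf, if_true, Sigma.smul_mk]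
  congr 1
  rw [MulAction.Quotient.smul_mk, QuotientGroup.eq]
  simpa using this

-- The generator `v` fixes the base wall of an adjacent `w`, so neither recolouring moves the wall
-- marked by the other.
open Classical in
theorem wallPerm_comm {v w : V} (h : Γ.Adj v w) :
    wallPerm Γ v * wallPerm Γ w = wallPerm Γ w * wallPerm Γ v := by
  ext φ W
  have e1 : (gen Γ v)⁻¹ • W = wallOf Γ (w, true) ↔ W = wallOf Γ (w, true) := by
    rw [inv_smul_eq_iff, gen_smul_wallOf h]
  have e2 : (gen Γ w)⁻¹ • W = wallOf Γ (v, true) ↔ W = wallOf Γ (v, true) := by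
    rw [inv_smul_eq_iff, gen_smul_wallOf h.symm]
  have e3 : (gen Γ w)⁻¹ • (gen Γ v)⁻¹ • W = (gen Γ v)⁻¹ • (gen Γ w)⁻¹ • W := by
    rw [smul_smul, smul_smul, ← mul_inv_rev, ← mul_inv_rev, gen_mul_comm h]
  have e1' : decide ((gen Γ v)⁻¹ • W = wallOf Γ (w, true)) = decide (W = wallOf Γ (w, true)) := by
    simp only [e1]
  have e2' : decide ((gen Γ w)⁻¹ • W = wallOf Γ (v, true)) = decide (W = wallOf Γ (v, true)) := by
    simp only [e2]
  simp only [Equiv.Perm.coe_mul, Function.comp_apply, wallPerm, Equiv.coe_fn_mk, e3]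
  rw [e1', e2', ← Bool.xor_assoc, ← Bool.xor_assoc, Bool.xor_comm (decide _) (decide _)]

/-- The action of `A(Γ)` on colourings of the walls that extends `wallPerm`. -/
noncomputable def wallHom (Γ : SimpleGraph V) : Artin Γ →* Equiv.Perm (Wall Γ → Bool) :=
  PresentedGroup.toGroup (f := wallPerm Γ) (by
    rintro r ⟨v, w, h, rfl⟩
    simp only [map_mul, map_inv, FreeGroup.lift_apply_of]
    rw [mul_inv_eq_one, mul_inv_eq_iff_eq_mul, wallPerm_comm h])

/-- `side g W` tells whether the wall `W` separates `1` from `g`. -/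
noncomputable def side (g : Artin Γ) (W : Wall Γ) : Bool := wallHom Γ g (fun _ => false) W

theorem artin_induction {p : Artin Γ → Prop} (one : p 1)
    (mul : ∀ g h, p g → p h → p (g * h)) (inv : ∀ g, p g → p g⁻¹) (of : ∀ v, p (gen Γ v))
    (g : Artin Γ) : p g := by
  have hg : g ∈ Subgroup.closure (Set.range (PresentedGroup.of (rels := relators Γ))) := by
    rw [PresentedGroup.closure_range_of]; trivial
  induction hg using Subgroup.closure_induction with
  | mem x hx => obtain ⟨v, rfl⟩ := hx; exact of v
  | one => exact one
  | mul x y _ _ hx hy => exact mul x y hx hy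
  | inv x _ hx => exact inv x hx

theorem wallHom_gen (v : V) : wallHom Γ (gen Γ v) = wallPerm Γ v :=
  PresentedGroup.toGroup.of _

/-- Every element acts by a translation followed by a fixed recolouring. This makes `side` a
cocycle. -/
theorem wallHom_apply (g : Artin Γ) (φ : Wall Γ → Bool) (W : Wall Γ) :
    wallHom Γ g φ W = xor (side g W) (φ (g⁻¹ • W)) := by
  induction g using artin_induction generalizing φ W with
  | one => simp [side]
  | mul g h hg hh =>
    simp only [side] at hg hh ⊢
    rw [map_mul, Equiv.Perm.mul_apply, Equiv.Perm.mul_apply, hg, hg (wallHom Γ h _) W, hh]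
    simp [mul_smul]
  | inv g hg =>
    have key : ∀ ψ : Wall Γ → Bool, ∀ W, (wallHom Γ g⁻¹ ψ) W
        = xor (side g (g • W)) (ψ (g • W)) := by
      intro ψ W
      have := hg (wallHom Γ g⁻¹ ψ) (g • W)
      rw [inv_smul_smul, ← Equiv.Perm.mul_apply, ← map_mul, mul_inv_cancel, map_one,
        Equiv.Perm.one_apply] at this
      rw [this]; simp
    simp only [side] at key ⊢
    rw [key, key]; simp
  | of v => simp [side, wallHom_gen, wallPerm]

theorem side_one (W : Wall Γ) : side (1 : Artin Γ) W = false := by simp [side]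

theorem side_mul (g h : Artin Γ) (W : Wall Γ) :
    side (g * h) W = xor (side g W) (side h (g⁻¹ • W)) := by
  conv_lhs => rw [side, map_mul, Equiv.Perm.mul_apply, wallHom_apply]
  rfl

open Classical in
theorem side_letter (a : V × Bool) (W : Wall Γ) :
    side (letter Γ a) W = decide (W = wallOf Γ a) := by
  have hgen : ∀ v W, side (gen Γ v) W = decide (W = wallOf Γ (v, true)) := by
    intro v W; simp [side, wallHom_gen, wallPerm]
  obtain ⟨v, _ | _⟩ := a
  · have h := side_mul (gen Γ v)⁻¹ (gen Γ v) W
    rw [inv_mul_cancel, side_one, hgen, inv_inv] at h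
    have h2 : gen Γ v • W = wallOf Γ (v, true) ↔ W = wallOf Γ (v, false) := by
      rw [← eq_inv_smul_iff]
      simp only [wallOf, if_true, Sigma.smul_mk, MulAction.Quotient.smul_mk]
      simp
    simp only [h2] at h
    simp only [letter, Bool.false_eq_true, if_false]
    revert h
    cases side (gen Γ v)⁻¹ W <;> simp
  · simpa [letter] using hgen v W

/-- The letter denoting the inverse. -/
def flip (a : V × Bool) : V × Bool := (a.1, !a.2)

theorem letter_smul_wallOf_flip (a : V × Bool) :
    letter Γ a • wallOf Γ (flip a) = wallOf Γ a := by
  obtain ⟨v, _ | _⟩ := a <;>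
    simp [letter, flip, wallOf]

theorem letter_flip (a : V × Bool) : letter Γ (flip a) = (letter Γ a)⁻¹ := by
  obtain ⟨v, _ | _⟩ := a <;> simp [letter, flip]

/-- Translation preserves labels, so the cocycle formula admits no new label under products and
inverses. -/
theorem label_mem_of_side {S : Set V} {g : Artin Γ} (hg : g ∈ vertexSubgroup Γ S) :
    ∀ W : Wall Γ, side g W = true → W.1 ∈ S := by
  induction hg using Subgroup.closure_induction with
  | mem x hx =>
    obtain ⟨v, hv, rfl⟩ := hx
    intro W hW
    classical
    have := side_letter (v, true) W
    simp only [letter, if_true] at this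
    rw [this] at hW
    rw [of_decide_eq_true hW, wallOf_label]
    exact hv
  | one => intro W hW; simp [side_one] at hW
  | mul x y _ _ hx hy =>
    intro W hW
    rw [side_mul] at hW
    by_cases h : side x W = true
    · exact hx W h
    · have := hy (x⁻¹ • W) (by simpa [h] using hW)
      simpa using this
  | inv x _ hx =>
    intro W hW
    have h := side_mul x⁻¹ x W
    rw [inv_mul_cancel, side_one, hW, inv_inv] at h
    have := hx (x • W) (by simpa using h)
    simpa using this

theorem commute_link {v : V} {z : Artin Γ} (hz : z ∈ vertexSubgroup Γ (Γ.neighborSet v)) :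
    Commute (gen Γ v) z := by
  induction hz using Subgroup.closure_induction with
  | mem x hx => obtain ⟨w, hw, rfl⟩ := hx; exact gen_commute hw
  | one => exact Commute.one_right _
  | mul x y _ _ hx hy => exact hx.mul_right hy
  | inv x _ hx => exact hx.inv_right

theorem letter_commute_link {a : V × Bool} {z : Artin Γ}
    (hz : z ∈ vertexSubgroup Γ (Γ.neighborSet a.1)) : Commute (letter Γ a) z := by
  have := commute_link hz
  unfold letter
  split_ifs <;> simp [this]

theorem smul_mk_eq_iff {v : V} {x g h : Artin Γ} :
    x • (⟨v, QuotientGroup.mk g⟩ : Wall Γ) = ⟨v, QuotientGroup.mk h⟩ ↔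
      h⁻¹ * x * g ∈ vertexSubgroup Γ (Γ.neighborSet v) := by
  rw [Sigma.smul_mk, MulAction.Quotient.smul_mk, Sigma.mk.injEq]
  simp only [true_and, heq_eq_eq, smul_eq_mul]
  rw [eq_comm, QuotientGroup.eq, mul_assoc]

/-- For an inverse letter the stabiliser is a conjugate of A(lk v) by a power of `v`, which is A(lk
v) again because `v` centralises it. -/
theorem mem_link_of_smul_wallOf {a : V × Bool} {x : Artin Γ}
    (h : x • wallOf Γ a = wallOf Γ a) : x ∈ vertexSubgroup Γ (Γ.neighborSet a.1) := by
  obtain ⟨v, _ | _⟩ := a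
  · simp only [wallOf, Bool.false_eq_true, if_false] at h
    rw [smul_mk_eq_iff, inv_inv] at h
    have h2 := commute_link h
    have h3 : gen Γ v * x * (gen Γ v)⁻¹ = x := by
      have h4 := h2.eq
      rw [← mul_assoc] at h4
      simpa [mul_assoc] using h4
    rwa [h3] at h
  · simp only [wallOf, if_true] at h
    rw [smul_mk_eq_iff] at h
    simpa using h

/-! ### Walls crossed by words -/

/-- The walls crossed by the path of the Cayley graph that starts at `g` and reads the word `u`. -/
def walls (Γ : SimpleGraph V) : Artin Γ → List (V × Bool) → List (Wall Γ)
  | _, [] => []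
  | g, a :: u => (g • wallOf Γ a) :: walls Γ (g * letter Γ a) u

@[simp] theorem eval_nil : eval Γ [] = 1 := rfl

@[simp] theorem eval_cons (a : V × Bool) (u : List (V × Bool)) :
    eval Γ (a :: u) = letter Γ a * eval Γ u := by simp [eval]

@[simp] theorem eval_append (u v : List (V × Bool)) :
    eval Γ (u ++ v) = eval Γ u * eval Γ v := by simp [eval]

theorem walls_append (g : Artin Γ) (u v : List (V × Bool)) :
    walls Γ g (u ++ v) = walls Γ g u ++ walls Γ (g * eval Γ u) v := by
  induction u generalizing g with
  | nil => simp [walls]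
  | cons a u ih => simp [walls, ih, mul_assoc]

@[simp] theorem length_walls (g : Artin Γ) (u : List (V × Bool)) :
    (walls Γ g u).length = u.length := by
  induction u generalizing g with
  | nil => rfl
  | cons a u ih => simp [walls, ih]

theorem mem_walls {g : Artin Γ} {u : List (V × Bool)} {W : Wall Γ} :
    W ∈ walls Γ g u ↔ ∃ u₁ a u₂, u = u₁ ++ a :: u₂ ∧ W = (g * eval Γ u₁) • wallOf Γ a := by
  constructor
  · induction u generalizing g with
    | nil => simp [walls]
    | cons a u ih =>
      intro h
      rcases List.mem_cons.mp h with h | h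
      · exact ⟨[], a, u, rfl, by simpa using h⟩
      · obtain ⟨u₁, b, u₂, rfl, hW⟩ := ih h
        exact ⟨a :: u₁, b, u₂, rfl, by simpa [mul_assoc] using hW⟩
  · rintro ⟨u₁, a, u₂, rfl, rfl⟩
    simp [walls_append, walls]

theorem exists_wall_of_mem {g : Artin Γ} {u : List (V × Bool)} {b : V × Bool} (hb : b ∈ u) :
    ∃ W ∈ walls Γ g u, W.1 = b.1 := by
  obtain ⟨u₁, u₂, rfl⟩ := List.append_of_mem hb
  exact ⟨_, mem_walls.mpr ⟨u₁, b, u₂, rfl, rfl⟩, by simp⟩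

/-- If some wall crossed by a path has a property, there is a first such wall. -/
theorem exists_first_wall {P : Wall Γ → Prop} {g : Artin Γ} {u : List (V × Bool)}
    (h : ∃ W ∈ walls Γ g u, P W) :
    ∃ u₁ a u₂, u = u₁ ++ a :: u₂ ∧ P ((g * eval Γ u₁) • wallOf Γ a) ∧
      ∀ W ∈ walls Γ g u₁, ¬ P W := by
  induction u generalizing g with
  | nil => simp [walls] at h
  | cons a u ih =>
    by_cases ha : P (g • wallOf Γ a)
    · exact ⟨[], a, u, rfl, by simpa using ha, by simp [walls]⟩
    · obtain ⟨W, hW, hP⟩ := h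
      rcases List.mem_cons.mp hW with rfl | hW
      · exact absurd hP ha
      · obtain ⟨u₁, b, u₂, rfl, hb, hu⟩ := ih ⟨W, hW, hP⟩
        refine ⟨a :: u₁, b, u₂, rfl, by simpa [mul_assoc] using hb, ?_⟩
        intro W' hW'
        rcases List.mem_cons.mp hW' with rfl | hW'
        · exact ha
        · exact hu W' hW'

theorem side_mul_letter_eq {g : Artin Γ} {a : V × Bool} {W : Wall Γ} (h : W ≠ g • wallOf Γ a) :
    side (g * letter Γ a) W = side g W := by
  classical
  rw [side_mul, side_letter]
  have : g⁻¹ • W ≠ wallOf Γ a := by rwa [Ne, inv_smul_eq_iff]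
  simp [this]

theorem side_mul_letter_ne (g : Artin Γ) (a : V × Bool) :
    side (g * letter Γ a) (g • wallOf Γ a) ≠ side g (g • wallOf Γ a) := by
  classical
  rw [side_mul, side_letter]
  simp

theorem side_eq_of_notMem_walls {g : Artin Γ} {u : List (V × Bool)} {W : Wall Γ}
    (h : W ∉ walls Γ g u) : side (g * eval Γ u) W = side g W := by
  induction u generalizing g with
  | nil => simp
  | cons a u ih =>
    simp only [walls, List.mem_cons, not_or] at h
    rw [eval_cons, ← mul_assoc, ih h.2, side_mul_letter_eq h.1]

theorem IsReduced.of_append_left {u v : List (V × Bool)} (h : IsReduced Γ (u ++ v)) :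
    IsReduced Γ u := by
  intro w hw
  have := h (w ++ v) (by simp [hw])
  simpa using this

theorem IsReduced.of_append_right {u v : List (V × Bool)} (h : IsReduced Γ (u ++ v)) :
    IsReduced Γ v := by
  intro w hw
  have := h (u ++ w) (by simp [hw])
  simpa using this

theorem exists_isReduced (g : Artin Γ) : ∃ u, IsReduced Γ u ∧ eval Γ u = g := by
  classical
  have h : ∃ n, ∃ u, eval Γ u = g ∧ u.length = n := by
    obtain ⟨u, hu⟩ := exists_eval_eq Γ g
    exact ⟨_, u, hu, rfl⟩
  obtain ⟨u, hu, hn⟩ := Nat.find_spec h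
  refine ⟨u, fun w hw => ?_, hu⟩
  rw [hn]
  exact Nat.find_min' h ⟨w, hw.trans hu, rfl⟩

/-- A reduced word crosses each wall at most once. -/
theorem IsReduced.nodup_walls {u : List (V × Bool)} (h : IsReduced Γ u) (g : Artin Γ) :
    (walls Γ g u).Nodup := by
  induction u generalizing g with
  | nil => simp [walls]
  | cons a u ih =>
    have hu : IsReduced Γ u := IsReduced.of_append_right (u := [a]) h
    refine List.nodup_cons.mpr ⟨fun hmem => ?_, ih hu _⟩
    have hnd := ih hu (g * letter Γ a)
    obtain ⟨u₁, b, u₂, rfl, hW⟩ := mem_walls.mp hmem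
    have hlab : b.1 = a.1 := by
      have := congrArg Sigma.fst hW
      simpa using this.symm
    rw [walls_append, walls] at hnd
    have hnot : g • wallOf Γ a ∉ walls Γ (g * letter Γ a) u₁ := by
      intro hm
      rw [hW] at hm
      exact (List.nodup_append.mp hnd).2.2 _ hm _ (List.mem_cons_self) rfl
    have hside := side_eq_of_notMem_walls hnot
    have hne := side_mul_letter_ne g a
    rw [mul_assoc, mul_smul, smul_left_cancel_iff, mul_smul] at hW
    -- A return by the same letter puts `letter a * eval u₁` in A(lk a), whose elements cross no
    -- wall labelled `a.1`, against the net change of side. A return by the inverse letter puts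
    -- `eval u₁` in A(lk a), so the two letters cancel and the word shortens.
    by_cases hb : b.2 = a.2
    · obtain rfl : b = a := Prod.ext hlab hb
      rw [← mul_smul] at hW
      have hz := mem_link_of_smul_wallOf hW.symm
      have h0 : side (letter Γ b * eval Γ u₁) (wallOf Γ b) ≠ true := by
        intro h1
        have := label_mem_of_side hz _ h1
        simp at this
      rw [← hside, mul_assoc, side_mul, inv_smul_smul, Bool.eq_false_iff.mpr h0] at hne
      simp at hne
    · obtain rfl : b = flip a := by
        refine Prod.ext hlab ?_
        simp only [flip]
        revert hb
        cases a.2 <;> cases b.2 <;> simp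
      rw [← letter_smul_wallOf_flip, smul_left_cancel_iff] at hW
      have hz := mem_link_of_smul_wallOf hW.symm
      have hc := letter_commute_link (a := a) hz
      have := h (u₁ ++ u₂) (by
        simp only [eval_append, eval_cons, letter_flip]
        rw [← mul_assoc, hc.eq]
        simp [mul_assoc])
      simp at this

theorem IsReduced.mem_walls_iff {u : List (V × Bool)} (h : IsReduced Γ u) (g : Artin Γ)
    (W : Wall Γ) : W ∈ walls Γ g u ↔ side (g * eval Γ u) W ≠ side g W := by
  refine ⟨fun hW => ?_, fun hW => by_contra fun hn => hW (side_eq_of_notMem_walls hn)⟩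
  obtain ⟨u₁, a, u₂, rfl, rfl⟩ := mem_walls.mp hW
  have hnd := h.nodup_walls g
  rw [walls_append, walls] at hnd
  have h1 : (g * eval Γ u₁) • wallOf Γ a ∉ walls Γ g u₁ := fun hm =>
    (List.nodup_append.mp hnd).2.2 _ hm _ (List.mem_cons_self) rfl
  have h2 : (g * eval Γ u₁) • wallOf Γ a ∉ walls Γ (g * eval Γ u₁ * letter Γ a) u₂ :=
    (List.nodup_cons.mp (List.nodup_append.mp hnd).2.1).1
  have e : g * eval Γ (u₁ ++ a :: u₂) = g * eval Γ u₁ * letter Γ a * eval Γ u₂ := by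
    simp [mul_assoc]
  rw [e, side_eq_of_notMem_walls h2, ← side_eq_of_notMem_walls h1]
  exact side_mul_letter_ne _ _

/-! ### Crossing walls have adjacent labels -/

/-- If two points on the same side of `E` are separated by `F`, there is an edge dual to `F` on
that side of `E`. -/
theorem exists_edge {E F : Wall Γ} {x y : Artin Γ} (hE : side x E = side y E)
    (hF : side x F ≠ side y F) :
    ∃ g, side g E = side x E ∧ F = g • wallOf Γ (F.1, true) := by
  obtain ⟨u, hu, hxy⟩ := exists_isReduced (x⁻¹ * y)
  have hy : y = x * eval Γ u := by rw [hxy]; group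
  subst hy
  have hFm := (hu.mem_walls_iff x F).mpr hF.symm
  have hEm : E ∉ walls Γ x u := fun hm => (hu.mem_walls_iff x E).mp hm hE.symm
  obtain ⟨u₁, a, u₂, rfl, hFe⟩ := mem_walls.mp hFm
  rw [walls_append, walls, List.mem_append, not_or, List.mem_cons, not_or] at hEm
  have h1 := side_eq_of_notMem_walls hEm.1
  obtain ⟨v, _ | _⟩ := a
  -- The edge must be read in the positive direction, so an inverse letter contributes its far end.
  · refine ⟨x * eval Γ u₁ * letter Γ (v, false), ?_, ?_⟩
    · rw [side_mul_letter_eq hEm.2.1, h1]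
    · have := congrArg Sigma.fst hFe
      simp only [smul_label, wallOf_label] at this
      rw [this, mul_smul]
      exact hFe.trans (by rw [← letter_smul_wallOf_flip]; rfl)
  · refine ⟨x * eval Γ u₁, h1, ?_⟩
    have := congrArg Sigma.fst hFe
    simp only [smul_label, wallOf_label] at this
    rw [this]
    exact hFe

/-- Walls all four of whose quadrants are inhabited have adjacent labels. -/
theorem adj_of_quadrants {E F : Wall Γ} {x y z t : Artin Γ}
    (hxy : side x E = side y E) (hzt : side z E = side t E) (hxz : side x E ≠ side z E)
    (hF : side x F ≠ side y F) (hF' : side z F ≠ side t F) : Γ.Adj E.1 F.1 := by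
  obtain ⟨g, hg, hFg⟩ := exists_edge hxy hF
  obtain ⟨k, hk, hFk⟩ := exists_edge hzt hF'
  -- Both edges are dual to `F`, so `g⁻¹ * k` lies in the link subgroup of `F.1`. Since `E`
  -- separates `g` from `k`, its label lies in that link.
  have h1 : (g⁻¹ * k) • wallOf Γ (F.1, true) = wallOf Γ (F.1, true) := by
    rw [mul_smul, ← hFk, inv_smul_eq_iff, ← hFg]
  have hz := mem_link_of_smul_wallOf h1
  have hs : side (g⁻¹ * k) (g⁻¹ • E) = true := by
    have h2 := side_mul g (g⁻¹ * k) E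
    rw [mul_inv_cancel_left, hk, hg] at h2
    revert h2 hxz
    cases side x E <;> cases side z E <;> simp
  have := label_mem_of_side hz _ hs
  simp only [smul_label, SimpleGraph.mem_neighborSet] at this
  exact this.symm

/-! ### Gates of cosets of vertex subgroups -/

theorem letter_commute_eval {a : V × Bool} {u : List (V × Bool)}
    (h : ∀ b ∈ u, Γ.Adj a.1 b.1) : Commute (letter Γ a) (eval Γ u) := by
  induction u with
  | nil => exact Commute.one_right _
  | cons b u ih =>
    rw [eval_cons]
    exact (letter_commute (h b (by simp))).mul_right (ih fun c hc => h c (by simp [hc]))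

theorem letter_mem {S : Set V} {a : V × Bool} (ha : a.1 ∈ S) :
    letter Γ a ∈ vertexSubgroup Γ S := by
  have : gen Γ a.1 ∈ vertexSubgroup Γ S := Subgroup.subset_closure ⟨_, ha, rfl⟩
  unfold letter
  split_ifs
  · exact this
  · exact inv_mem this

theorem eval_mem {S : Set V} {u : List (V × Bool)} (hu : ∀ a ∈ u, a.1 ∈ S) :
    eval Γ u ∈ vertexSubgroup Γ S := by
  induction u with
  | nil => exact one_mem _
  | cons a u ih =>
    rw [eval_cons]
    exact mul_mem (letter_mem (hu a (by simp))) (ih fun c hc => hu c (by simp [hc]))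

/-- Closest point projection to a coset of a vertex subgroup: there is a reduced word from the
coset to `p` no letter of which can be moved into the coset, and no wall that it crosses separates
points of the coset. -/
theorem exists_gate (S : Set V) (y₀ p : Artin Γ) :
    ∃ y u, y₀⁻¹ * y ∈ vertexSubgroup Γ S ∧ IsReduced Γ u ∧ y * eval Γ u = p ∧
      (∀ u₁ a u₂, u = u₁ ++ a :: u₂ → (∀ b ∈ u₁, Γ.Adj a.1 b.1) → a.1 ∉ S) ∧
      ∀ y', y₀⁻¹ * y' ∈ vertexSubgroup Γ S → ∀ W ∈ walls Γ y u, side y' W = side y W := by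
  classical
  have hex : ∃ n, ∃ y u, y₀⁻¹ * y ∈ vertexSubgroup Γ S ∧ y * eval Γ u = p ∧ u.length = n := by
    obtain ⟨u, hu⟩ := exists_eval_eq Γ (y₀⁻¹ * p)
    exact ⟨_, y₀, u, by simp, by rw [hu]; group, rfl⟩
  obtain ⟨y, u, hy, hp, hn⟩ := Nat.find_spec hex
  have hred : IsReduced Γ u := by
    intro w hw
    rw [hn]
    exact Nat.find_min' hex ⟨y, w, hy, by rw [hw, hp], rfl⟩
  have hmin : ∀ u₁ a u₂, u = u₁ ++ a :: u₂ → (∀ b ∈ u₁, Γ.Adj a.1 b.1) → a.1 ∉ S := by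
    rintro u₁ a u₂ rfl hc ha
    have hcomm := letter_commute_eval hc
    have : Nat.find hex ≤ (u₁ ++ u₂).length :=
      Nat.find_min' hex ⟨y * letter Γ a, u₁ ++ u₂, by
        rw [← mul_assoc]; exact mul_mem hy (letter_mem ha), by
        rw [← hp, eval_append, eval_append, eval_cons, mul_assoc, ← mul_assoc (letter Γ a),
          hcomm.eq, mul_assoc (eval Γ u₁)], rfl⟩
    rw [← hn] at this
    simp at this
  refine ⟨y, u, hy, hred, hp, hmin, ?_⟩
  by_contra hcon
  push Not at hcon
  obtain ⟨z, hz, W₀, hW₀, hsW₀⟩ := hcon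
  -- Take the first wall of `u` separating `y` from a point of the coset. It crosses the walls of
  -- all earlier letters, so `a` can be moved to the front, and its label lies in `S`: this
  -- contradicts minimality.
  obtain ⟨u₁, a, u₂, rfl, ⟨y', hy', hW⟩, hfirst⟩ := exists_first_wall
    (P := fun W => ∃ y', y₀⁻¹ * y' ∈ vertexSubgroup Γ S ∧ side y' W ≠ side y W)
    ⟨W₀, hW₀, z, hz, hsW₀⟩
  set W := (y * eval Γ u₁) • wallOf Γ a with hWdef
  have hlab : W.1 = a.1 := by simp [hWdef]
  have hWmem : W ∈ walls Γ y (u₁ ++ a :: u₂) := mem_walls.mpr ⟨u₁, a, u₂, rfl, rfl⟩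
  have hWp := (hred.mem_walls_iff y W).mp hWmem
  have hnd := hred.nodup_walls y
  rw [walls_append, walls] at hnd
  have hW1 : side (y * eval Γ u₁) W = side y W := side_eq_of_notMem_walls fun hm =>
    (List.nodup_append.mp hnd).2.2 _ hm _ (List.mem_cons_self) rfl
  refine hmin u₁ a u₂ rfl ?_ ?_
  · intro b hb
    obtain ⟨G, hG, hGb⟩ := exists_wall_of_mem (Γ := Γ) (g := y) hb
    have hG1 := (hred.of_append_left.mem_walls_iff y G).mp hG
    have hGp := (hred.mem_walls_iff y G).mp (by rw [walls_append]; simp [hG])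
    have hGy : side y' G = side y G := by
      by_contra hne
      exact hfirst G hG ⟨y', hy', hne⟩
    rw [← hlab, ← hGb]
    refine adj_of_quadrants (x := y) (y := y * eval Γ u₁) (z := y')
      (t := y * eval Γ (u₁ ++ a :: u₂)) hW1.symm ?_ hW.symm hG1.symm ?_
    · revert hW hWp
      cases side y' W <;> cases side y W <;>
        cases side (y * eval Γ (u₁ ++ a :: u₂)) W <;> simp
    · rw [hGy]; exact hGp.symm
  · have hm : y⁻¹ * y' ∈ vertexSubgroup Γ S := by
      have := mul_mem (inv_mem hy) hy'
      simpa [mul_assoc] using this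
    rw [← hlab, ← smul_label y⁻¹ W]
    apply label_mem_of_side hm
    have := side_mul y (y⁻¹ * y') W
    rw [mul_inv_cancel_left] at this
    revert this hW
    cases side y' W <;> cases side y W <;> simp

/-! ### Nested walls along reduced words -/

theorem IsReduced.mem_walls_one_iff {u : List (V × Bool)} (h : IsReduced Γ u) (W : Wall Γ) :
    W ∈ walls Γ 1 u ↔ side (eval Γ u) W = true := by
  rw [h.mem_walls_iff, side_one, one_mul]
  simp

theorem sides_of_mem_walls_middle {w₁ β w₂ : List (V × Bool)} (h : IsReduced Γ (w₁ ++ β ++ w₂))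
    {E : Wall Γ} (hE : E ∈ walls Γ (eval Γ w₁) β) :
    side (eval Γ w₁) E = false ∧ side (eval Γ (w₁ ++ β)) E = true ∧
      side (eval Γ (w₁ ++ β ++ w₂)) E = true := by
  have h12 := h.of_append_left
  have e12 : side (eval Γ (w₁ ++ β)) E = true := by
    rw [← h12.mem_walls_one_iff, walls_append]
    simp [hE]
  refine ⟨?_, e12, ?_⟩
  · have := (h12.of_append_right.mem_walls_iff (eval Γ w₁) E).mp hE
    rw [← eval_append, e12] at this
    simpa using this.symm
  · rw [← h.mem_walls_one_iff, walls_append, walls_append]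
    simp [hE]

/-- The wall `F` lies behind the wall `E`, as seen from `1`. -/
def Nested (E F : Wall Γ) : Prop := ∀ x, side x F = true → side x E = true

theorem Nested.trans {E F G : Wall Γ} (h : Nested E F) (h' : Nested F G) : Nested E G :=
  fun x hx => h x (h' x hx)

/-- A point behind the second wall but not the first would, together with 1, the start of the edge
`b` and the end of the word, occupy all four quadrants. -/
theorem nested_of_not_adj {x y z : List (V × Bool)} {a b : V × Bool}
    (h : IsReduced Γ (x ++ a :: (y ++ b :: z))) (hab : ¬ Γ.Adj a.1 b.1) :
    Nested (eval Γ x • wallOf Γ a) (eval Γ (x ++ a :: y) • wallOf Γ b) := by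
  intro t ht
  by_contra hne
  rw [Bool.not_eq_true] at hne
  have hA := sides_of_mem_walls_middle (w₁ := x) (β := [a]) (w₂ := y ++ b :: z)
    (E := eval Γ x • wallOf Γ a) (by simpa using h) (by simp [walls])
  have hA' := sides_of_mem_walls_middle (w₁ := x) (β := [a]) (w₂ := y)
    (E := eval Γ x • wallOf Γ a)
    (by
      have : IsReduced Γ ((x ++ [a] ++ y) ++ b :: z) := by simpa using h
      exact this.of_append_left) (by simp [walls])
  have hB := sides_of_mem_walls_middle (w₁ := x ++ a :: y) (β := [b]) (w₂ := z)
    (E := eval Γ (x ++ a :: y) • wallOf Γ b) (by simpa using h) (by simp [walls])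
  have e1 : x ++ [a] ++ y = x ++ a :: y := by simp
  have e2 : x ++ a :: y ++ [b] ++ z = x ++ [a] ++ (y ++ b :: z) := by simp
  rw [e1] at hA'
  rw [e2] at hB
  have := adj_of_quadrants (E := eval Γ x • wallOf Γ a)
    (F := eval Γ (x ++ a :: y) • wallOf Γ b) (x := 1) (y := t) (z := eval Γ (x ++ a :: y))
    (t := eval Γ (x ++ [a] ++ (y ++ b :: z)))
    (by rw [side_one, hne]) (by rw [hA.2.2, hA'.2.2]) (by rw [side_one, hA'.2.2]; simp)
    (by rw [side_one, ht]; simp) (by rw [hB.1, hB.2.2]; simp)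
  simp at this
  exact hab this

/-- In a reduced word, letters of `L` that are separated by a long enough word in the letters of
`L` have nested walls, if `L` is not a join and long subwords in the letters of `L` contain all
letters of `L`. -/
theorem nested_of_long {L : Finset V} {n : ℕ} {w : List (V × Bool)} (hw : IsReduced Γ w)
    (hanti : ∀ A ⊆ L, A.Nonempty → A ≠ L → ∃ m' ∈ A, ∃ m ∈ L, m ∉ A ∧ ¬ Γ.Adj m' m)
    (hfull : ∀ y₁ y y₂, w = y₁ ++ y ++ y₂ → (∀ a ∈ y, a.1 ∈ L) → n ≤ y.length →
      ∀ ℓ ∈ L, ∃ b ∈ y, b.1 = ℓ)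
    {x y z : List (V × Bool)} {a b : V × Bool} (hxy : w = x ++ a :: (y ++ b :: z))
    (ha : a.1 ∈ L) (hb : b.1 ∈ L) (hy : ∀ c ∈ y, c.1 ∈ L) (hlen : L.card * n ≤ y.length) :
    Nested (eval Γ x • wallOf Γ a) (eval Γ (x ++ a :: y) • wallOf Γ b) := by
  classical
  -- `A` collects labels whose walls are nested behind that of `a` after a gap of `k * n` letters.
  -- It grows with each `k` until it is all of `L`.
  have key : ∀ k : ℕ, ∃ A ⊆ L, A.Nonempty ∧ (k + 1 ≤ A.card ∨ A = L) ∧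
      ∀ y b z, w = x ++ a :: (y ++ b :: z) → (∀ c ∈ y, c.1 ∈ L) → k * n ≤ y.length → b.1 ∈ A →
        Nested (eval Γ x • wallOf Γ a) (eval Γ (x ++ a :: y) • wallOf Γ b) := by
    intro k
    induction k with
    | zero =>
      refine ⟨{a.1}, by simpa using ha, by simp, by simp, ?_⟩
      rintro y b z rfl - - hb
      rw [Finset.mem_singleton] at hb
      exact nested_of_not_adj hw (by rw [hb]; exact Γ.loopless.irrefl _)
    | succ k ih =>
      obtain ⟨A, hAL, hAne, hAc, hA⟩ := ih
      have hstep : (k + 1) * n = k * n + n := by ring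
      by_cases hAL' : A = L
      · exact ⟨A, hAL, hAne, Or.inr hAL', fun y b z h1 h2 h3 h4 =>
          hA y b z h1 h2 (by omega) h4⟩
      · obtain ⟨m', hm', m, hm, hmA, hadj⟩ := hanti A hAL hAne hAL'
        refine ⟨insert m A, Finset.insert_subset hm hAL, by simp, Or.inl ?_, ?_⟩
        · rw [Finset.card_insert_of_notMem hmA]
          rcases hAc with h | h
          · omega
          · exact absurd h hAL'
        · intro y b z h1 h2 h3 h4
          rcases Finset.mem_insert.mp h4 with h4 | h4
          swap
          · exact hA y b z h1 h2 (by omega) h4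
          -- The first `k * n` letters serve as the inductive gap. The rest contains `m'`, whose
          -- wall is behind that of `a` and, as `m'` and `m` are not adjacent, before that of `b`.
          have hlt : (y.drop (k * n)).length ≥ n := by rw [List.length_drop]; omega
          obtain ⟨b', hb', hb'm⟩ := hfull (x ++ a :: y.take (k * n)) (y.drop (k * n)) (b :: z)
            (by
              rw [h1]
              conv_lhs => rw [← List.take_append_drop (k * n) y]
              simp only [List.append_assoc, List.cons_append])
            (fun c hc => h2 c (List.mem_of_mem_drop hc)) hlt m' (hAL hm')
          obtain ⟨y₃, y₄, hy34⟩ := List.append_of_mem hb'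
          have hyeq : y = (y.take (k * n) ++ y₃) ++ b' :: y₄ := by
            rw [List.append_assoc, ← hy34, List.take_append_drop]
          have hlen3 : k * n ≤ (y.take (k * n) ++ y₃).length := by
            rw [List.length_append, List.length_take]; omega
          generalize y.take (k * n) ++ y₃ = y₅ at hyeq hlen3
          subst hyeq
          have n1 := hA y₅ b' (y₄ ++ b :: z) (by rw [h1]; simp)
            (fun c hc => h2 c (by simp [hc])) hlen3 (by rw [hb'm]; exact hm')
          have n2 := nested_of_not_adj (x := x ++ a :: y₅) (y := y₄) (z := z) (a := b') (b := b)
            (by rw [h1] at hw; simpa using hw) (by rw [hb'm, h4]; exact hadj)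
          have := n1.trans n2
          simpa using this
  obtain ⟨A, hAL, -, hAc, hA⟩ := key L.card
  have hA' : A = L := by
    rcases hAc with h | h
    · have := Finset.card_le_card hAL
      omega
    · exact h
  exact hA y b z hxy hy hlen (hA'.symm ▸ hb)

/-! ### Gates of points between walls of a subword -/

/-- The common link of a set of vertices. -/
def commonLink (Γ : SimpleGraph V) (L : Set V) : Set V := {v | ∀ ℓ ∈ L, Γ.Adj ℓ v}

/-- If a point `p` lies between walls of a subword `β` with all labels in `L`, then each wall that
separates `p` from the closest point of the coset of `A(L ∪ lk L)` containing `β` separates `p` from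
both end points of the whole word. -/
theorem exists_gate_of_between {L : Set V} {w₁ β w₂ : List (V × Bool)}
    (hw : IsReduced Γ (w₁ ++ β ++ w₂)) (hβ : ∀ b ∈ β, b.1 ∈ L) (p : Artin Γ)
    (hafter : ∀ ℓ ∈ L, ∃ E ∈ walls Γ (eval Γ w₁) β, E.1 = ℓ ∧ side p E = true)
    (hbefore : ∀ ℓ ∈ L, ∃ E ∈ walls Γ (eval Γ w₁) β, E.1 = ℓ ∧ side p E = false) :
    ∃ y u, (eval Γ w₁)⁻¹ * y ∈ vertexSubgroup Γ (L ∪ commonLink Γ L) ∧ IsReduced Γ u ∧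
      y * eval Γ u = p ∧
      ∀ W ∈ walls Γ y u, side (eval Γ (w₁ ++ β ++ w₂)) W = false ∧ side p W = true := by
  obtain ⟨y, u, hy, hu, hp, hmin, hsep⟩ :=
    exists_gate (Γ := Γ) (L ∪ commonLink Γ L) (eval Γ w₁) p
  set h := eval Γ (w₁ ++ β ++ w₂) with hh
  have hend : (eval Γ w₁)⁻¹ * eval Γ (w₁ ++ β) ∈ vertexSubgroup Γ (L ∪ commonLink Γ L) := by
    rw [eval_append, inv_mul_cancel_left]
    exact eval_mem fun a ha => Or.inl (hβ a ha)
  have hs1 : ∀ W ∈ walls Γ y u, side (eval Γ w₁) W = side y W :=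
    hsep _ (by rw [inv_mul_cancel]; exact one_mem _)
  have hs2 : ∀ W ∈ walls Γ y u, side (eval Γ (w₁ ++ β)) W = side y W := hsep _ hend
  have hps : ∀ W ∈ walls Γ y u, side p W ≠ side y W := fun W hW => by
    rw [← hp]; exact (hu.mem_walls_iff y W).mp hW
  have hy0 : ∀ W ∈ walls Γ y u, side h W = false → side y W = false := by
    intro W hW hWh
    rw [← hs1 W hW]
    by_contra hne
    rw [Bool.not_eq_false, ← hw.of_append_left.of_append_left.mem_walls_one_iff] at hne
    have : side h W = true := by
      rw [hh, ← hw.mem_walls_one_iff, walls_append, walls_append]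
      simp [hne]
    rw [hWh] at this
    cases this
  refine ⟨y, u, hy, hu, hp, fun W₀ hW₀ => ?_⟩
  by_cases hW₀h : side h W₀ = false
  · refine ⟨hW₀h, ?_⟩
    have := hps W₀ hW₀
    rw [hy0 W₀ hW₀ hW₀h] at this
    simpa using this
  exfalso
  -- The first wall of `u` behind which `h` lies crosses all earlier walls of `u` and, for each `ℓ ∈
  -- L`, a wall of `β` labelled `ℓ`. So `a` moves to the front and lies in the common link, which
  -- the gate forbids.
  obtain ⟨u₁, a, u₂, rfl, hWh, hfirst⟩ := exists_first_wall
    (P := fun W => side h W = true) ⟨W₀, hW₀, by simpa using hW₀h⟩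
  set W := (y * eval Γ u₁) • wallOf Γ a with hWdef
  have hlab : W.1 = a.1 := by simp [hWdef]
  have hWmem : W ∈ walls Γ y (u₁ ++ a :: u₂) := mem_walls.mpr ⟨u₁, a, u₂, rfl, rfl⟩
  have hWp := hps W hWmem
  have hnd := hu.nodup_walls y
  rw [walls_append, walls] at hnd
  have hW1 : side (y * eval Γ u₁) W = side y W := side_eq_of_notMem_walls fun hm =>
    (List.nodup_append.mp hnd).2.2 _ hm _ (List.mem_cons_self) rfl
  have hcomm : ∀ b ∈ u₁, Γ.Adj a.1 b.1 := by
    intro b hb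
    obtain ⟨G, hG, hGb⟩ := exists_wall_of_mem (Γ := Γ) (g := y) hb
    have hG1 := (hu.of_append_left.mem_walls_iff y G).mp hG
    have hGm : G ∈ walls Γ y (u₁ ++ a :: u₂) := by rw [walls_append]; simp [hG]
    have hGh : side h G = false := by simpa using hfirst G hG
    have hGy := hy0 G hGm hGh
    have hGp := hps G hGm
    rw [← hlab, ← hGb]
    -- The side of `W` containing `p` also contains `h` or 1, according to the side of `y`; that end
    -- of the word supplies the fourth quadrant.
    cases hsy : side y W
    · refine adj_of_quadrants (x := y) (y := y * eval Γ u₁) (z := h) (t := p) hW1.symm ?_ ?_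
        hG1.symm ?_
      · rw [hsy] at hWp; rw [hWh]; simpa using hWp.symm
      · rw [hsy, hWh]; simp
      · rw [hGh, ← hGy]; exact hGp.symm
    · refine adj_of_quadrants (x := y) (y := y * eval Γ u₁) (z := 1) (t := p) hW1.symm ?_ ?_
        hG1.symm ?_
      · rw [hsy] at hWp; rw [side_one]; simpa using hWp.symm
      · rw [hsy, side_one]; simp
      · rw [side_one, ← hGy]; exact hGp.symm
  refine hmin u₁ a u₂ rfl hcomm (Or.inr fun ℓ hℓ => ?_)
  have h12 : side (eval Γ w₁) W = side (eval Γ (w₁ ++ β)) W := by rw [hs1 W hWmem, hs2 W hWmem]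
  cases hsy : side y W
  · obtain ⟨E, hE, rfl, hpE⟩ := hbefore ℓ hℓ
    obtain ⟨e1, e2, e3⟩ := sides_of_mem_walls_middle hw hE
    rw [← hlab]
    refine (adj_of_quadrants (x := eval Γ w₁) (y := eval Γ (w₁ ++ β)) (z := p) (t := h)
      h12 ?_ ?_ ?_ ?_).symm
    · rw [hsy] at hWp; rw [hWh]; simpa using hWp
    · rw [hs1 W hWmem]; exact hWp.symm
    · rw [e1, e2]; simp
    · rw [hpE, e3]; simp
  · obtain ⟨E, hE, rfl, hpE⟩ := hafter ℓ hℓ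
    obtain ⟨e1, e2, e3⟩ := sides_of_mem_walls_middle hw hE
    rw [← hlab]
    refine (adj_of_quadrants (x := eval Γ w₁) (y := eval Γ (w₁ ++ β)) (z := p) (t := 1)
      h12 ?_ ?_ ?_ ?_).symm
    · rw [hsy] at hWp; rw [side_one]; simpa using hWp
    · rw [hs1 W hWmem]; exact hWp.symm
    · rw [e1, e2]; simp
    · rw [hpE, side_one]; simp

/-! ### The free action on walls and geodesics of H -/

theorem finite_side (g : Artin Γ) : {W : Wall Γ | side g W = true}.Finite := by
  obtain ⟨u, hu⟩ := exists_eval_eq Γ g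
  refine (List.finite_toSet (walls Γ 1 u)).subset fun W hW => ?_
  by_contra hn
  have := side_eq_of_notMem_walls hn
  rw [one_mul, hu, side_one] at this
  rw [Set.mem_ofPred_eq, this] at hW
  cases hW

theorem side_inv_mul_of_ne {g k : Artin Γ} {W : Wall Γ} (h : side g W ≠ side k W) :
    side (g⁻¹ * k) (g⁻¹ • W) = true := by
  have := side_mul g (g⁻¹ * k) W
  rw [mul_inv_cancel_left] at this
  revert this h
  cases side g W <;> cases side k W <;> simp

theorem eq_one_of_conj_mem {H : Subgroup (Artin Γ)} (hlox : IsPurelyLoxodromic Γ H) {J : Set V}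
    (hJ : IsJoin Γ J) {q : Artin Γ} (hq : q ∈ H) (x : Artin Γ)
    (hx : x * q * x⁻¹ ∈ vertexSubgroup Γ J) : q = 1 := by
  by_contra hne
  exact hlox q hq hne ⟨J, hJ, x, hx⟩

/-- A purely loxodromic subgroup acts freely on the walls. -/
theorem eq_one_of_smul_wall {H : Subgroup (Artin Γ)} (hlox : IsPurelyLoxodromic Γ H)
    {q : Artin Γ} (hq : q ∈ H) {W : Wall Γ} (h : q • W = W) : q = 1 := by
  obtain ⟨v, c⟩ := W
  obtain ⟨g, rfl⟩ := QuotientGroup.mk_surjective c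
  have hm := smul_mk_eq_iff.mp h
  -- The star of `v` is a join unless the link is empty, and in that case the stabiliser is trivial.
  by_cases hv : (Γ.neighborSet v).Nonempty
  · refine eq_one_of_conj_mem hlox (J := {v} ∪ Γ.neighborSet v)
      ⟨{v}, Γ.neighborSet v, by simp, hv, by simp, rfl, by simp⟩ hq g⁻¹ ?_
    rw [inv_inv]
    exact Subgroup.closure_mono (Set.image_mono Set.subset_union_right) hm
  · rw [Set.not_nonempty_iff_eq_empty] at hv
    rw [hv, vertexSubgroup, Set.image_empty, Subgroup.closure_empty, Subgroup.mem_bot] at hm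
    have : q = g * (g⁻¹ * q * g) * g⁻¹ := by group
    rw [this, hm]
    group

/-- By freeness, at most one element of `H` carries a given wall to another given wall. -/
theorem finite_transporter {H : Subgroup (Artin Γ)} (hlox : IsPurelyLoxodromic Γ H)
    {𝓔 : Set (Wall Γ)} (h𝓔 : 𝓔.Finite) :
    {q | q ∈ H ∧ ∃ E ∈ 𝓔, q • E ∈ 𝓔}.Finite := by
  have : {q | q ∈ H ∧ ∃ E ∈ 𝓔, q • E ∈ 𝓔} ⊆ ⋃ E ∈ 𝓔, ⋃ F ∈ 𝓔, {q | q ∈ H ∧ q • E = F} := by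
    rintro q ⟨hq, E, hE, hF⟩
    simp only [Set.mem_iUnion]
    exact ⟨E, hE, _, hF, hq, rfl⟩
  refine (h𝓔.biUnion fun E _ => h𝓔.biUnion fun F _ => ?_).subset this
  apply Set.Subsingleton.finite
  rintro q ⟨hq, hqE⟩ r ⟨hr, hrE⟩
  have : q⁻¹ * r = 1 := by
    refine eq_one_of_smul_wall hlox (W := E) (mul_mem (inv_mem hq) hr) ?_
    rw [mul_smul, hrE, ← hqE, inv_smul_smul]
  exact (inv_mul_eq_one.mp this)

/-- A word of minimal length in the elements of `T`. -/
def IsGeodesic {G : Type*} [Group G] (T : Set G) (l : List G) : Prop :=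
  (∀ s ∈ l, s ∈ T) ∧ ∀ l' : List G, (∀ s ∈ l', s ∈ T) → l'.prod = l.prod → l.length ≤ l'.length

theorem IsGeodesic.of_append_left {G : Type*} [Group G] {T : Set G} {l₁ l₂ : List G}
    (h : IsGeodesic T (l₁ ++ l₂)) : IsGeodesic T l₁ := by
  refine ⟨fun s hs => h.1 s (by simp [hs]), fun l' hl' hp => ?_⟩
  have := h.2 (l' ++ l₂) (fun s hs => (List.mem_append.mp hs).elim (hl' s)
    fun hs => h.1 s (by simp [hs])) (by simp [hp])
  simpa using this

theorem IsGeodesic.of_append_right {G : Type*} [Group G] {T : Set G} {l₁ l₂ : List G}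
    (h : IsGeodesic T (l₁ ++ l₂)) : IsGeodesic T l₂ := by
  refine ⟨fun s hs => h.1 s (by simp [hs]), fun l' hl' hp => ?_⟩
  have := h.2 (l₁ ++ l') (fun s hs => (List.mem_append.mp hs).elim
    (fun hs => h.1 s (by simp [hs])) (hl' s)) (by simp [hp])
  simpa using this

theorem exists_isGeodesic {G : Type*} [Group G] {T : Set G} {g : G}
    (h : ∃ l : List G, (∀ s ∈ l, s ∈ T) ∧ l.prod = g) :
    ∃ l : List G, IsGeodesic T l ∧ l.prod = g := by
  classical
  have hex : ∃ n, ∃ l : List G, (∀ s ∈ l, s ∈ T) ∧ l.prod = g ∧ l.length = n := by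
    obtain ⟨l, h1, h2⟩ := h
    exact ⟨_, l, h1, h2, rfl⟩
  obtain ⟨l, h1, h2, h3⟩ := Nat.find_spec hex
  refine ⟨l, ⟨h1, fun l' h1' h2' => ?_⟩, h2⟩
  rw [h3]
  exact Nat.find_min' hex ⟨l', h1', h2'.trans h2, rfl⟩

theorem finite_words {α : Type*} {T : Set α} (hT : T.Finite) (n : ℕ) :
    {l : List α | (∀ s ∈ l, s ∈ T) ∧ l.length ≤ n}.Finite := by
  have := hT.to_subtype
  refine ((List.finite_length_le T n).image (List.map Subtype.val)).subset ?_
  rintro l ⟨h1, h2⟩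
  lift l to List T using h1
  exact ⟨l, by simpa using h2, rfl⟩

/-- A finite symmetric generating set, in terms of words. -/
theorem exists_finite_generators {G : Type*} [Group G] {H : Subgroup G} (h : H.FG) :
    ∃ T : Set G, T.Finite ∧ T ⊆ H ∧ ∀ g ∈ H, ∃ l : List G, (∀ s ∈ l, s ∈ T) ∧ l.prod = g := by
  obtain ⟨S, rfl⟩ := h
  refine ⟨{x | x ∈ S ∨ x⁻¹ ∈ S}, ?_, ?_, fun g hg => ?_⟩
  · refine (S.finite_toSet.union (S.finite_toSet.image (·⁻¹))).subset ?_
    rintro x (hx | hx)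
    · exact Or.inl hx
    · exact Or.inr ⟨_, hx, inv_inv x⟩
  · rintro x (hx | hx)
    · exact Subgroup.subset_closure hx
    · exact inv_mem_iff.mp (Subgroup.subset_closure hx)
  · rw [← Subgroup.mem_toSubmonoid, Subgroup.closure_toSubmonoid] at hg
    obtain ⟨l, hl, hp⟩ := Submonoid.exists_list_of_mem_closure hg
    exact ⟨l, hl, hp⟩

theorem exists_crossing {g : Artin Γ} {l : List (Artin Γ)} {W : Wall Γ}
    (h : side g W ≠ side (g * l.prod) W) :
    ∃ l₁ s l₂, l = l₁ ++ s :: l₂ ∧ side s ((g * l₁.prod)⁻¹ • W) = true := by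
  induction l generalizing g with
  | nil => simp at h
  | cons s l ih =>
    by_cases hs : side g W = side (g * s) W
    · obtain ⟨l₁, t, l₂, rfl, ht⟩ := ih (g := g * s) (by
        rw [← hs]; simpa [mul_assoc] using h)
      exact ⟨s :: l₁, t, l₂, rfl, by simpa [mul_assoc] using ht⟩
    · refine ⟨[], s, l, rfl, ?_⟩
      have := side_inv_mul_of_ne hs
      simpa using this

/-- The walls that separate a point of a geodesic of `H` from both end points lie, up to
translation, in a finite set. -/
theorem exists_finite_walls {H : Subgroup (Artin Γ)} (hlox : IsPurelyLoxodromic Γ H)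
    {T : Set (Artin Γ)} (hT : T.Finite) (hTH : T ⊆ H)
    (hgen : ∀ g ∈ H, ∃ l : List (Artin Γ), (∀ s ∈ l, s ∈ T) ∧ l.prod = g) :
    ∃ 𝓕 : Set (Wall Γ), 𝓕.Finite ∧ ∀ l₁ l₂ : List (Artin Γ), IsGeodesic T (l₁ ++ l₂) → ∀ W,
      side (l₁ ++ l₂).prod W = false → side l₁.prod W = true → l₁.prod⁻¹ • W ∈ 𝓕 := by
  set 𝓔 : Set (Wall Γ) := ⋃ s ∈ T, {W | side s W = true} with h𝓔def
  have h𝓔 : 𝓔.Finite := hT.biUnion fun s _ => finite_side s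
  have hQ := finite_transporter hlox h𝓔
  choose! word hword using hgen
  obtain ⟨D, hD⟩ := (hQ.image fun q => (word q).length).bddAbove
  refine ⟨⋃ l ∈ {l : List (Artin Γ) | (∀ s ∈ l, s ∈ T) ∧ l.length ≤ D},
    (fun W => l.prod⁻¹ • W) '' 𝓔, (finite_words hT D).biUnion fun l _ => h𝓔.image _, ?_⟩
  intro l₁ l₂ hl W hh hp
  -- `W` is crossed before and again after the point. The stretch between the crossings carries one
  -- wall of `𝓔` to another, so it is one of finitely many elements and, being geodesic, has length
  -- at most `D`.
  obtain ⟨a, s, b, rfl, hs⟩ := exists_crossing (g := 1) (l := l₁) (W := W)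
    (by rw [side_one, one_mul, hp]; simp)
  obtain ⟨a', s', b', rfl, hs'⟩ := exists_crossing (g := (a ++ s :: b).prod) (l := l₂) (W := W)
    (by rw [← List.prod_append, hh, hp]; simp)
  rw [one_mul] at hs
  have hTm := hl.1
  have hs𝓔 : a.prod⁻¹ • W ∈ 𝓔 :=
    Set.mem_biUnion (hTm s (by simp)) hs
  have hs'𝓔 : ((a ++ s :: b).prod * a'.prod)⁻¹ • W ∈ 𝓔 :=
    Set.mem_biUnion (hTm s' (by simp)) hs'
  have hgeo : IsGeodesic T (s :: b ++ a') := by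
    have : IsGeodesic T (a ++ ((s :: b ++ a') ++ s' :: b')) := by simpa using hl
    exact this.of_append_right.of_append_left
  have hmemH : (s :: b ++ a').prod ∈ H := H.list_prod_mem fun x hx => hTH (hgeo.1 x hx)
  have hq : (s :: b ++ a').prod ∈ {q | q ∈ H ∧ ∃ E ∈ 𝓔, q • E ∈ 𝓔} := by
    refine ⟨hmemH, _, hs'𝓔, ?_⟩
    convert hs𝓔 using 1
    rw [smul_smul]
    congr 1
    simp [mul_assoc]
  have hle : (word (s :: b ++ a').prod).length ≤ D := hD ⟨_, hq, rfl⟩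
  have hle' := hgeo.2 _ (hword _ hmemH).1 (hword _ hmemH).2
  simp only [Set.mem_iUnion]
  refine ⟨s :: b, ⟨fun x hx => hgeo.1 x (by simp only [List.mem_append]; exact Or.inl hx), ?_⟩,
    _, hs𝓔, ?_⟩
  · rw [List.length_append] at hle'
    omega
  · simp [mul_smul]

theorem length_le_ncard {l : List (Wall Γ)} (hl : l.Nodup) (g : Artin Γ) {𝓕 : Set (Wall Γ)}
    (h𝓕 : 𝓕.Finite) (h : ∀ W ∈ l, g • W ∈ 𝓕) : l.length ≤ 𝓕.ncard := by
  classical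
  have hnd : (l.map (g • ·)).Nodup := hl.map (MulAction.injective g)
  have := List.toFinset_card_of_nodup hnd
  rw [List.length_map] at this
  rw [← this, ← Set.ncard_coe_finset]
  refine Set.ncard_le_ncard (fun W hW => ?_) h𝓕
  simp only [List.coe_toFinset, List.mem_map, Set.mem_ofPred_eq] at hW
  obtain ⟨W', hW', rfl⟩ := hW
  exact h W' hW'

/-! ### The bound for a flanked subword -/

theorem isJoin_union_commonLink {L : Set V} (hL : L.Nonempty) (hK : (commonLink Γ L).Nonempty) :
    IsJoin Γ (L ∪ commonLink Γ L) := by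
  refine ⟨L, commonLink Γ L, hL, hK, ?_, rfl, fun v hv w hw => hw v hv⟩
  rw [Set.disjoint_left]
  exact fun v hv hv' => Γ.loopless.irrefl v (hv' v hv)

/-- A geodesic of `H` cannot stay long between the front walls and the back walls of `β₁`: there it
fellow-travels a coset of a join subgroup, which can happen only at boundedly many points. -/
theorem exists_bound_of_nested [Finite V] {H : Subgroup (Artin Γ)} (hfg : H.FG)
    (hlox : IsPurelyLoxodromic Γ H) :
    ∃ N : ℕ, ∀ L : Set V, L.Nonempty → (commonLink Γ L).Nonempty →
      ∀ w₁ β₀ β₁ β₂ w₂ : List (V × Bool), IsReduced Γ (w₁ ++ (β₀ ++ β₁ ++ β₂) ++ w₂) →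
      eval Γ (w₁ ++ (β₀ ++ β₁ ++ β₂) ++ w₂) ∈ H → (∀ b ∈ β₀ ++ β₁ ++ β₂, b.1 ∈ L) →
      (∀ ℓ ∈ L, ∃ E ∈ walls Γ (eval Γ w₁) (β₀ ++ β₁ ++ β₂), E.1 = ℓ ∧
        ∀ F ∈ walls Γ (eval Γ (w₁ ++ β₀)) β₁, Nested E F) →
      (∀ ℓ ∈ L, ∃ E ∈ walls Γ (eval Γ w₁) (β₀ ++ β₁ ++ β₂), E.1 = ℓ ∧
        ∀ F ∈ walls Γ (eval Γ (w₁ ++ β₀)) β₁, Nested F E) →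
      β₁.length ≤ N := by
  classical
  obtain ⟨T, hT, hTH, hgen⟩ := exists_finite_generators hfg
  obtain ⟨𝓕, h𝓕, hlocal⟩ := exists_finite_walls hlox hT hTH hgen
  set 𝓑 : Set (Artin Γ) :=
    eval Γ '' {u : List (V × Bool) | (∀ a ∈ u, a ∈ Set.univ) ∧ u.length ≤ 𝓕.ncard} with h𝓑def
  have h𝓑 : 𝓑.Finite := (finite_words Set.finite_univ _).image _
  -- The extra 1 is there because a stretch of the geodesic has at most one step more than it has
  -- interior points.
  set 𝓢 : Set (Wall Γ) := ⋃ l ∈ {l : List (Artin Γ) | (∀ s ∈ l, s ∈ T) ∧ l.length ≤ 𝓑.ncard + 1},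
    {W | side l.prod W = true} with h𝓢def
  have h𝓢 : 𝓢.Finite := (finite_words hT _).biUnion fun l _ => finite_side _
  refine ⟨𝓢.ncard, ?_⟩
  intro L hL hK w₁ β₀ β₁ β₂ w₂ hw hwH hβ hE hE'
  obtain ⟨l, hl, hlp⟩ := exists_isGeodesic (hgen _ hwH)
  set w := w₁ ++ (β₀ ++ β₁ ++ β₂) ++ w₂ with hwdef
  have : Nonempty (Wall Γ) := ⟨wallOf Γ (hL.some, true)⟩
  choose! e' he'm he'l he'n using hE
  choose! e hem hel hen using hE'
  obtain ⟨ℓ₀, hℓ₀⟩ := hL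
  let p : ℕ → Artin Γ := fun t => (l.take t).prod
  have hpgeo : ∀ t, IsGeodesic T (l.take t) := fun t => by
    have : IsGeodesic T (l.take t ++ l.drop t) := by rwa [List.take_append_drop]
    exact this.of_append_left
  have hpH : ∀ t, p t ∈ H := fun t => H.list_prod_mem fun x hx => hTH ((hpgeo t).1 x hx)
  have hpn : p l.length = eval Γ w := by simp [p, hlp]
  have hpinj : ∀ t t', t ≤ l.length → t' ≤ l.length → p t = p t' → t = t' := by
    intro t t' ht ht' h
    have h1 := (hpgeo t).2 _ (hpgeo t').1 h.symm
    have h2 := (hpgeo t').2 _ (hpgeo t).1 h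
    simp only [List.length_take] at h1 h2
    omega
  -- Past all front walls `e'` and before all back walls `e`, each wall of the gate path separates
  -- `p t` from both ends of the geodesic, so the path has at most `𝓕.ncard` letters.
  have hgood : ∀ t, (∀ ℓ ∈ L, side (p t) (e' ℓ) = true) → (∀ ℓ ∈ L, side (p t) (e ℓ) = false) →
      ∃ x ∈ 𝓑, (eval Γ w₁)⁻¹ * (p t * x⁻¹) ∈ vertexSubgroup Γ (L ∪ commonLink Γ L) := by
    intro t h1 h2
    obtain ⟨y, u, hy, hu, hyu, hsep⟩ := exists_gate_of_between hw hβ (p t)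
      (fun ℓ hℓ => ⟨_, he'm ℓ hℓ, he'l ℓ hℓ, h1 ℓ hℓ⟩)
      (fun ℓ hℓ => ⟨_, hem ℓ hℓ, hel ℓ hℓ, h2 ℓ hℓ⟩)
    refine ⟨eval Γ u, ⟨u, ⟨fun _ _ => Set.mem_univ _, ?_⟩, rfl⟩, ?_⟩
    · rw [← length_walls (Γ := Γ) y u]
      refine length_le_ncard (hu.nodup_walls y) (p t)⁻¹ h𝓕 fun W hW => ?_
      refine hlocal (l.take t) (l.drop t) (by rwa [List.take_append_drop]) W ?_ (hsep W hW).2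
      rw [List.take_append_drop, hlp]
      exact (hsep W hW).1
    · rw [← hyu, mul_inv_cancel_right]
      exact hy
  by_cases hβ₁ : β₁ = []
  · simp [hβ₁]
  -- `T₁` is the first time some back wall is crossed, and `T₀` the last time up to `T₁` at which
  -- some front wall is not; all times strictly between are good.
  have hT₁ex : ∃ t, ∃ ℓ ∈ L, side (p t) (e ℓ) = true :=
    ⟨l.length, ℓ₀, hℓ₀, by
      rw [hpn]; exact (sides_of_mem_walls_middle hw (hem ℓ₀ hℓ₀)).2.2⟩
  obtain ⟨ℓ₁, hℓ₁, hT₁⟩ := Nat.find_spec hT₁ex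
  have hT₁n : Nat.find hT₁ex ≤ l.length := Nat.find_min' hT₁ex
    ⟨ℓ₀, hℓ₀, by rw [hpn]; exact (sides_of_mem_walls_middle hw (hem ℓ₀ hℓ₀)).2.2⟩
  have hT₁min : ∀ t < Nat.find hT₁ex, ∀ ℓ ∈ L, side (p t) (e ℓ) = false := by
    intro t ht ℓ hℓ
    have := Nat.find_min hT₁ex ht
    push Not at this
    simpa using this ℓ hℓ
  generalize Nat.find hT₁ex = T₁ at hT₁ hT₁n hT₁min
  have hP0 : ∃ ℓ ∈ L, side (p 0) (e' ℓ) = false := ⟨ℓ₀, hℓ₀, by simp [p, side_one]⟩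
  obtain ⟨ℓ₂, hℓ₂, hT₀⟩ := Nat.findGreatest_spec
    (P := fun t => ∃ ℓ ∈ L, side (p t) (e' ℓ) = false) (Nat.zero_le T₁) hP0
  have hT₀le := Nat.findGreatest_le (P := fun t => ∃ ℓ ∈ L, side (p t) (e' ℓ) = false) T₁
  have hT₀max : ∀ t, Nat.findGreatest (fun t => ∃ ℓ ∈ L, side (p t) (e' ℓ) = false) T₁ < t →
      t ≤ T₁ → ∀ ℓ ∈ L, side (p t) (e' ℓ) = true := by
    intro t ht ht' ℓ hℓ
    have := Nat.findGreatest_is_greatest ht ht'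
    push Not at this
    simpa using this ℓ hℓ
  generalize Nat.findGreatest (fun t => ∃ ℓ ∈ L, side (p t) (e' ℓ) = false) T₁ = T₀
    at hT₀ hT₀le hT₀max
  have hcard : T₁ - T₀ - 1 ≤ 𝓑.ncard := by
    have hx : ∀ t ∈ Finset.Ioo T₀ T₁, ∃ x ∈ 𝓑,
        (eval Γ w₁)⁻¹ * (p t * x⁻¹) ∈ vertexSubgroup Γ (L ∪ commonLink Γ L) := by
      intro t ht
      rw [Finset.mem_Ioo] at ht
      exact hgood t (hT₀max t ht.1 ht.2.le) (hT₁min t ht.2)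
    choose! x hx𝓑 hx using hx
    rw [← Nat.card_Ioo, ← Set.ncard_coe_finset]
    -- Equal offsets conjugate `(p t)⁻¹ * p t'` into a join subgroup, so it is trivial, and a
    -- geodesic visits no point twice.
    refine Set.ncard_le_ncard_of_injOn x (fun t ht => hx𝓑 t ht) (fun t ht t' ht' hxx => ?_) h𝓑
    have h1 := hx t ht
    have h2 := hx t' ht'
    rw [← hxx] at h2
    have h3 := mul_mem (inv_mem h1) h2
    have h4 : x t * ((p t)⁻¹ * p t') * (x t)⁻¹ ∈ vertexSubgroup Γ (L ∪ commonLink Γ L) := by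
      convert h3 using 1
      group
    have h5 := eq_one_of_conj_mem hlox (isJoin_union_commonLink ⟨ℓ₀, hℓ₀⟩ hK)
      (mul_mem (inv_mem (hpH t)) (hpH t')) _ h4
    have ht := Finset.mem_Ioo.mp ht
    have ht' := Finset.mem_Ioo.mp ht'
    exact hpinj t t' (by omega) (by omega) (inv_mul_eq_one.mp h5)
  have hmidp : p T₁ = p T₀ * ((l.take T₁).drop T₀).prod := by
    have : l.take T₀ = (l.take T₁).take T₀ := by rw [List.take_take, min_eq_left hT₀le]
    simp only [p]
    rw [this, ← List.prod_append, List.take_append_drop]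
  have hmid : (p T₀)⁻¹ * p T₁ = ((l.take T₁).drop T₀).prod := by
    rw [hmidp, inv_mul_cancel_left]
  have hmidlen : ((l.take T₁).drop T₀).length ≤ 𝓑.ncard + 1 := by
    rw [List.length_drop, List.length_take]
    omega
  have hred₁ : IsReduced Γ β₁ := by
    have := hw.of_append_left.of_append_right.of_append_left
    exact this.of_append_right
  rw [← length_walls (Γ := Γ) (eval Γ (w₁ ++ β₀)) β₁]
  refine length_le_ncard (hred₁.nodup_walls _) (p T₀)⁻¹ h𝓢 fun F hF => ?_
  -- By nestedness every wall of `β₁` separates `p T₀` from `p T₁`.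
  have hF0 : side (p T₀) F = false := by
    by_contra hne
    have := he'n ℓ₂ hℓ₂ F hF (p T₀) (by simpa using hne)
    rw [hT₀] at this
    cases this
  have hF1 : side (p T₁) F = true := hen ℓ₁ hℓ₁ F hF _ hT₁
  have hs := side_inv_mul_of_ne (g := p T₀) (k := p T₁) (W := F) (by rw [hF0, hF1]; simp)
  rw [hmid] at hs
  exact Set.mem_biUnion (x := (l.take T₁).drop T₀)
    ⟨fun s hs => hl.1 s (List.mem_of_mem_take (List.mem_of_mem_drop hs)), hmidlen⟩ hs

/-! ### Induction on the support -/

theorem eval_filter_mul {p : V × Bool → Bool} {β : List (V × Bool)}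
    (h : ∀ a ∈ β, ∀ b ∈ β, p a = true → p b = false → Γ.Adj a.1 b.1) :
    eval Γ (β.filter p) * eval Γ (β.filter (fun b => !p b)) = eval Γ β := by
  induction β with
  | nil => simp
  | cons b β ih =>
    have ih := ih fun a ha c hc => h a (by simp [ha]) c (by simp [hc])
    cases hb : p b
    · rw [List.filter_cons_of_neg (by simp [hb]), List.filter_cons_of_pos (by simp [hb])]
      have hc : Commute (letter Γ b) (eval Γ (β.filter p)) :=
        letter_commute_eval fun a ha => by
          rw [List.mem_filter] at ha
          exact (h a (by simp [ha.1]) b (by simp) ha.2 hb).symm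
      rw [eval_cons, ← mul_assoc, ← hc.eq, mul_assoc, ih, eval_cons]
    · rw [List.filter_cons_of_pos (by simp [hb]), List.filter_cons_of_neg (by simp [hb])]
      rw [eval_cons, mul_assoc, ih, eval_cons]

/-- Subwords with letters in a subset of a join have bounded length in the reduced words that
represent elements of `H`. -/
theorem exists_bound_of_subset_join [Finite V] {H : Subgroup (Artin Γ)} (hfg : H.FG)
    (hlox : IsPurelyLoxodromic Γ H) {J : Set V} (hJ : IsJoin Γ J) (L : Finset V)
    (hLJ : (L : Set V) ⊆ J) :
    ∃ N : ℕ, ∀ w₁ β w₂ : List (V × Bool), IsReduced Γ (w₁ ++ β ++ w₂) →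
      eval Γ (w₁ ++ β ++ w₂) ∈ H → (∀ b ∈ β, b.1 ∈ L) → β.length ≤ N := by
  classical
  induction L using Finset.strongInduction with
  | H L ih =>
  rcases L.eq_empty_or_nonempty with rfl | hLne
  · refine ⟨0, fun w₁ β w₂ _ _ hβ => ?_⟩
    rcases β with _ | ⟨b, β⟩
    · simp
    · simpa using hβ b (by simp)
  by_cases hanti : ∀ A ⊆ L, A.Nonempty → A ≠ L → ∃ m' ∈ A, ∃ m ∈ L, m ∉ A ∧ ¬ Γ.Adj m' m
  swap
  -- `L` is a join of `A` and `L \ A`. Sorting the letters of `β` changes neither the element nor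
  -- the length, so the word stays reduced.
  · push Not at hanti
    obtain ⟨A, hAL, hAne, hAL', hadj⟩ := hanti
    obtain ⟨N₁, hN₁⟩ := ih A (hAL.ssubset_of_ne hAL') (fun v hv => hLJ (hAL hv))
    obtain ⟨N₂, hN₂⟩ := ih (L \ A) (Finset.sdiff_ssubset hAL hAne)
      (fun v hv => hLJ (Finset.sdiff_subset hv))
    refine ⟨N₁ + N₂, fun w₁ β w₂ hw hwH hβ => ?_⟩
    set β₁ := β.filter (fun b => decide (b.1 ∈ A)) with hβ₁
    set β₂ := β.filter (fun b => !decide (b.1 ∈ A)) with hβ₂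
    have hev : eval Γ (β₁ ++ β₂) = eval Γ β := by
      rw [eval_append]
      refine eval_filter_mul fun a ha b hb h1 h2 => ?_
      exact hadj a.1 (by simpa using h1) b.1 (hβ b hb) (by simpa using h2)
    have hlen : β₁.length + β₂.length = β.length :=
      (List.length_eq_length_filter_add (l := β) (fun b => decide (b.1 ∈ A))).symm
    have hev' : eval Γ (w₁ ++ (β₁ ++ β₂) ++ w₂) = eval Γ (w₁ ++ β ++ w₂) := by
      rw [eval_append, eval_append, hev, ← eval_append, ← eval_append]
    have hw' : IsReduced Γ (w₁ ++ (β₁ ++ β₂) ++ w₂) := by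
      intro v hv
      have := hw v (hv.trans hev')
      simp only [List.length_append] at this ⊢
      omega
    rw [← hev'] at hwH
    have h1 := hN₁ w₁ β₁ (β₂ ++ w₂) (by simpa using hw') (by simpa using hwH) (fun b hb => by
      simp only [hβ₁, List.mem_filter, decide_eq_true_eq] at hb
      exact hb.2)
    have h2 := hN₂ (w₁ ++ β₁) β₂ w₂ (by simpa using hw') (by simpa [mul_assoc] using hwH)
      (fun b hb => by
        simp only [hβ₂, List.mem_filter, Bool.not_eq_true', decide_eq_false_iff_not] at hb
        exact Finset.mem_sdiff.mpr ⟨hβ b hb.1, hb.2⟩)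
    omega
  -- An anti-connected `L` cannot meet both factors of `J`; the factor it misses lies in its common
  -- link.
  have hlink : (commonLink Γ (L : Set V)).Nonempty := by
    obtain ⟨J₁, J₂, ⟨j₁, hj₁⟩, ⟨j₂, hj₂⟩, -, rfl, hadj⟩ := hJ
    by_cases h1 : L.filter (· ∈ J₁) = ∅
    · refine ⟨j₁, fun ℓ hℓ => (hadj j₁ hj₁ ℓ ?_).symm⟩
      refine (hLJ hℓ).resolve_left fun h => ?_
      have : ℓ ∈ L.filter (· ∈ J₁) := Finset.mem_filter.mpr ⟨hℓ, h⟩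
      rw [h1] at this
      simp at this
    · by_cases h2 : L.filter (· ∈ J₁) = L
      · refine ⟨j₂, fun ℓ hℓ => hadj ℓ ?_ j₂ hj₂⟩
        rw [Finset.mem_coe, ← h2] at hℓ
        exact (Finset.mem_filter.mp hℓ).2
      · obtain ⟨m', hm', m, hm, hmn, hna⟩ := hanti _ (Finset.filter_subset _ _)
          (Finset.nonempty_iff_ne_empty.mpr h1) h2
        refine absurd (hadj m' (Finset.mem_filter.mp hm').2 m ?_) hna
        exact (hLJ hm).resolve_left fun h => hmn (Finset.mem_filter.mpr ⟨hm, h⟩)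
  have ih' : ∀ ℓ ∈ L, ∃ N : ℕ, ∀ w₁ β w₂ : List (V × Bool), IsReduced Γ (w₁ ++ β ++ w₂) →
      eval Γ (w₁ ++ β ++ w₂) ∈ H → (∀ b ∈ β, b.1 ∈ L.erase ℓ) → β.length ≤ N :=
    fun ℓ hℓ => ih _ (Finset.erase_ssubset hℓ) fun v hv => hLJ (Finset.erase_subset _ _ hv)
  choose! N₀ hN₀ using ih'
  obtain ⟨N₁, hN₁⟩ := exists_bound_of_nested hfg hlox
  -- By induction, a subword of length `n` in the letters of `L` omits none of them.
  set n := L.sup N₀ + 1 with hn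
  have hfull : ∀ w : List (V × Bool), IsReduced Γ w → eval Γ w ∈ H → ∀ y₁ y y₂,
      w = y₁ ++ y ++ y₂ → (∀ a ∈ y, a.1 ∈ L) → n ≤ y.length → ∀ ℓ ∈ L, ∃ b ∈ y, b.1 = ℓ := by
    rintro w hw hwH y₁ y y₂ rfl hy hlen ℓ hℓ
    by_contra hcon
    push Not at hcon
    have h1 := hN₀ ℓ hℓ y₁ y y₂ hw hwH fun b hb =>
      Finset.mem_erase.mpr ⟨hcon b hb, hy b hb⟩
    have h2 : N₀ ℓ ≤ L.sup N₀ := Finset.le_sup hℓ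
    omega
  -- Two outer blocks of length `n` contain walls of every label, two buffers of length `L.card * n`
  -- make these nested with the walls of the middle block, and `N₁` bounds that block.
  refine ⟨2 * n + 2 * (L.card * n) + N₁, fun w₁ β w₂ hw hwH hβ => ?_⟩
  by_contra hlt
  push Not at hlt
  obtain ⟨b₀, c₀, β₁, c₁, b₁, rfl, hb₀, hc₀, hβ₁, hc₁, hb₁⟩ : ∃ b₀ c₀ β₁ c₁ b₁,
      β = (b₀ ++ c₀) ++ β₁ ++ (c₁ ++ b₁) ∧ b₀.length = n ∧ c₀.length = L.card * n ∧
        N₁ < β₁.length ∧ c₁.length = L.card * n ∧ b₁.length = n := by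
    have hsplit : ∀ (k : ℕ) (γ : List (V × Bool)), k ≤ γ.length → ∃ s t, γ = s ++ t ∧
        s.length = k ∧ t.length = γ.length - k := fun k γ hk =>
      ⟨γ.take k, γ.drop k, (List.take_append_drop k γ).symm, by simp [hk], by simp⟩
    obtain ⟨b₀, γ₁, rfl, h1, h1'⟩ := hsplit n β (by omega)
    obtain ⟨c₀, γ₂, rfl, h2, h2'⟩ := hsplit (L.card * n) γ₁ (by omega)
    obtain ⟨β₁, γ₃, rfl, h3, h3'⟩ := hsplit (γ₂.length - (L.card * n + n)) γ₂ (by omega)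
    simp only [List.length_append] at hlt h1' h2' h3 h3'
    obtain ⟨c₁, b₁, rfl, h4, h4'⟩ := hsplit (L.card * n) γ₃ (by omega)
    simp only [List.length_append] at hlt h1' h2' h3 h3' h4'
    exact ⟨b₀, c₀, β₁, c₁, b₁, by simp, h1, h2, by omega, h4, by omega⟩
  have hw' := hfull _ hw hwH
  refine hβ₁.not_ge (hN₁ L hLne hlink w₁ (b₀ ++ c₀) β₁ (c₁ ++ b₁) w₂ hw hwH hβ ?_ ?_)
  · intro ℓ hℓ
    obtain ⟨b, hb, rfl⟩ := hw' w₁ b₀ (c₀ ++ β₁ ++ (c₁ ++ b₁) ++ w₂) (by simp)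
      (fun a ha => hβ a (by simp [ha])) hb₀.ge ℓ hℓ
    obtain ⟨s, s', rfl⟩ := List.append_of_mem hb
    refine ⟨eval Γ (w₁ ++ s) • wallOf Γ b, ?_, by simp, fun F hF => ?_⟩
    · refine mem_walls.mpr ⟨s, b, s' ++ c₀ ++ β₁ ++ (c₁ ++ b₁), by simp, by rw [eval_append]⟩
    · obtain ⟨r, a, r', rfl, rfl⟩ := mem_walls.mp hF
      have := nested_of_long (x := w₁ ++ s) (a := b) (y := s' ++ c₀ ++ r) (b := a)
        (z := r' ++ (c₁ ++ b₁) ++ w₂) hw hanti hw' (by simp) hℓ (hβ a (by simp))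
        (fun c hc => hβ c (by
          simp only [List.mem_append, List.mem_cons] at hc ⊢
          tauto)) (by simp only [List.length_append]; omega)
      rw [← eval_append]
      simpa only [List.append_assoc, List.cons_append] using this
  · intro ℓ hℓ
    obtain ⟨b, hb, rfl⟩ := hw' (w₁ ++ (b₀ ++ c₀ ++ β₁ ++ c₁)) b₁ w₂ (by simp)
      (fun a ha => hβ a (by simp [ha])) hb₁.ge ℓ hℓ
    obtain ⟨s, s', rfl⟩ := List.append_of_mem hb
    refine ⟨eval Γ (w₁ ++ (b₀ ++ c₀ ++ β₁ ++ c₁ ++ s)) • wallOf Γ b, ?_, by simp,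
      fun F hF => ?_⟩
    · exact mem_walls.mpr ⟨b₀ ++ c₀ ++ β₁ ++ c₁ ++ s, b, s', by simp, by rw [eval_append w₁]⟩
    · obtain ⟨r, a, r', rfl, rfl⟩ := mem_walls.mp hF
      have := nested_of_long (x := w₁ ++ (b₀ ++ c₀) ++ r) (a := a) (y := r' ++ c₁ ++ s) (b := b)
        (z := s' ++ w₂) hw hanti hw' (by simp) (hβ a (by simp)) hℓ
        (fun c hc => hβ c (by
          simp only [List.mem_append, List.mem_cons] at hc ⊢
          tauto)) (by simp only [List.length_append]; omega)
      rw [← eval_append]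
      simpa only [List.append_assoc, List.cons_append] using this

end RAAG

theorem theorem5p2 {V : Type*} [Finite V] (Γ : SimpleGraph V)
    (hconn : Γ.Connected) (hanti : Γᶜ.Connected)
    (H : Subgroup (RAAG.Artin Γ)) (hfg : H.FG) (hlox : RAAG.IsPurelyLoxodromic Γ H) :
    ∃ N : ℕ, RAAG.IsJoinBusting Γ H N := by
  classical
  have := Fintype.ofFinite V
  have hbound : ∀ L : Finset V, (∃ J, RAAG.IsJoin Γ J ∧ (L : Set V) ⊆ J) → ∃ N : ℕ,
      ∀ w₁ β w₂ : List (V × Bool), RAAG.IsReduced Γ (w₁ ++ β ++ w₂) →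
      RAAG.eval Γ (w₁ ++ β ++ w₂) ∈ H → (∀ b ∈ β, b.1 ∈ L) → β.length ≤ N := by
    rintro L ⟨J, hJ, hLJ⟩
    exact RAAG.exists_bound_of_subset_join hfg hlox hJ L hLJ
  choose! N hN using hbound
  refine ⟨Finset.univ.sup N, ?_⟩
  rintro w hw hwH β ⟨w₁, w₂, rfl⟩ ⟨J, hJ, hβJ⟩
  have hlen := hN J.toFinset ⟨J, hJ, by simp⟩ w₁ β w₂ hw hwH fun b hb => by
    refine Set.mem_toFinset.mpr (hβJ ?_)
    obtain ⟨v, _ | _⟩ := b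
    · exact Or.inr hb
    · exact Or.inl hb
  calc RAAG.wordLength Γ (RAAG.eval Γ β) ≤ β.length := Nat.sInf_le ⟨β, rfl, rfl⟩
    _ ≤ N J.toFinset := hlen
    _ ≤ Finset.univ.sup N := Finset.le_sup (Finset.mem_univ _)
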